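/- Let $\gamma_n$ ($n\ge 0$) be the Stieltjes constants, defined by the Laurent expansion $\zeta(s)=\frac1{s-1}+\sum_{n\ge0}\frac{(-1)^n}{n!}\gamma_n(s-1)^n$, let $\psi=\Gamma'/\Gamma$ be the digamma function with derivatives $\psi^{(j)}$, and let $Y_n(x_1,\dots,x_n)=\sum \frac{n!}{k_1!\cdots k_n!}\prod_{j=1}^n\left(\frac{x_j}{j!}\right)^{k_j}$ (sum over all integers $k_j\ge 0$ with $k_1+2k_2+\dots+nk_n=n$; $Y_0=1$) be the complete exponential Bell polynomials. Put $\mathbf Y_k=Y_k(-\psi(1),-\psi^{(1)}(1),\dots,-\psi^{(k-1)}(1))$ and $$p_n(z)=\sum_{k=0}^n\binom nk(-1)^k\,\mathbf Y_k\,z^{n-k}=\sum_{k=0}^n\binom nk(-1)^{n-k}\,\mathbf Y_{n-k}\,z^{k}.$$ Call a sequence of real polynomials $(q_n)_{n\ge0}$ an Appell sequence if $\deg q_n=n$ for all $n\ge 0$ and $q_n'=n\,q_{n-1}$ for all $n\ge1$. Then: 1. For all $n\ge0$, $$\gamma_n=(-1)^n\sum_{k=0}^n\binom nk\mathbf Y_k\int_0^1\log^{n-k}\!\left[\log(1/t)\right]\left[\frac1{\log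 t}+\frac1{1-t}\right]dt ,$$ where all the integrals converge absolutely. 2. For all $n\ge0$, $p_n$ has degree $n$ and $$\gamma_n=\int_0^1p_n\!\left(-\log\log(1/t)\right)\left[\frac1{\log t}+\frac1{1-t}\right]dt ,$$ the integral being absolutely convergent. 3. $p_n'=n\,p_{n-1}$ for $n\ge1$, so $(p_n)$ is an Appell sequence; consequently $p_n(z)=\sum_{k=0}^n\binom nk p_{n-k}(0)z^k$ and $p_n(x+y)=\sum_{k=0}^n\binom nk p_k(x)y^{n-k}$ for all $n\ge 0$ and real $x,y,z$. 4. $(p_n)$ is the only Appell sequence of real polynomials for which the formula in 2 holds for all $n\ge0$. -/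

import Mathlib

open Polynomial

noncomputable section

/-- The Stieltjes constant `γ_n`: `(-1)^n / n! * γ_n` is the coefficient of `(s - 1)^n` in the
Laurent expansion of the Riemann zeta function at `s = 1`. Here `riemannZeta₀` is the entire
function `ζ(s) - 1 / (s - 1)`. -/
def stieltjesConstant (n : ℕ) : ℂ := (-1) ^ n * iteratedDeriv n riemannZeta₀ 1

/-- The Laurent expansion of zeta at `1`, with the Stieltjes constants as its coefficients. -/
theorem hasSum_stieltjesConstant {s : ℂ} (hs : s ≠ 1) :
    HasSum (fun n : ℕ => (-1) ^ n / (n.factorial : ℂ) * stieltjesConstant n * (s - 1) ^ n)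
      (riemannZeta s - 1 / (s - 1)) := by
  have h := Complex.hasSum_taylorSeries_of_entire differentiable_riemannZeta₀ 1 s
  have e : riemannZeta₀ s = riemannZeta s - 1 / (s - 1) := by simp [riemannZeta₀, hs]
  rw [e] at h
  refine h.congr_fun ?_
  intro n
  have h1 : ((-1 : ℂ) ^ n) * (-1) ^ n = 1 := by rw [← mul_pow]; simp
  simp only [stieltjesConstant, smul_eq_mul]
  linear_combination (s - 1) ^ n * iteratedDeriv n riemannZeta₀ 1 / (n.factorial : ℂ) * h1

/-- The digamma function `ψ = Γ' / Γ` of a real variable. -/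
def realDigamma : ℝ → ℝ := logDeriv Real.Gamma

/-- On the positive reals `realDigamma` is the restriction of the complex digamma function. -/
theorem ofReal_realDigamma {x : ℝ} (hx : 0 < x) :
    ((realDigamma x : ℝ) : ℂ) = Complex.digamma x := by
  have hd : DifferentiableAt ℂ Complex.Gamma x :=
    Complex.differentiableAt_Gamma _ fun m h => by
      have h' : x = -(m : ℝ) := by exact_mod_cast h
      have : (0 : ℝ) ≤ m := m.cast_nonneg
      linarith
  have h1 := hd.hasDerivAt.comp_ofReal
  have h2 : HasDerivAt (fun y : ℝ => ((Real.Gamma y : ℝ) : ℂ)) (deriv Real.Gamma x : ℝ) x :=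
    (Real.differentiableAt_Gamma fun m h => by
      have : (0 : ℝ) ≤ m := m.cast_nonneg
      linarith).hasDerivAt.ofReal_comp
  simp only [Complex.Gamma_ofReal] at h1
  rw [realDigamma, Complex.digamma_def, logDeriv_apply, logDeriv_apply, h1.unique h2,
    Complex.Gamma_ofReal, Complex.ofReal_div]

/-- The complete exponential Bell polynomial `Y_n(x_1, …, x_n)`, evaluated at a sequence `x` of
which only the entries `x 1, …, x n` are used: the sum over the partitions of `n`, in which the
part `j` occurs `k_j` times, of `n! / (k_1! ⋯ k_n!) * ∏ j, (x_j / j!) ^ k_j`. -/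
def completeBell (n : ℕ) (x : ℕ → ℝ) : ℝ :=
  ∑ π : n.Partition,
    (n.factorial : ℝ) / (∏ j ∈ Finset.Icc 1 n, ((π.parts.count j).factorial : ℝ)) *
      ∏ j ∈ Finset.Icc 1 n, (x j / (j.factorial : ℝ)) ^ π.parts.count j

/-- The number `Y_k(-ψ(1), -ψ⁽¹⁾(1), …, -ψ⁽ᵏ⁻¹⁾(1))`. -/
def bellPsi (k : ℕ) : ℝ := completeBell k fun j => -iteratedDeriv (j - 1) realDigamma 1

/-- The polynomial
`p_n(z) = ∑ k ≤ n, (n choose k) (-1)^k Y_k(-ψ(1), …, -ψ⁽ᵏ⁻¹⁾(1)) z^(n-k)`. -/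
def bredePoly (n : ℕ) : ℝ[X] :=
  ∑ k ∈ Finset.range (n + 1), C ((n.choose k : ℝ) * (-1) ^ k * bellPsi k) * X ^ (n - k)

/-- Appell sequences of real polynomials. -/
def IsAppellSequence (q : ℕ → ℝ[X]) : Prop :=
  (∀ n : ℕ, (q n).degree = n) ∧ ∀ n : ℕ, 1 ≤ n → derivative (q n) = C (n : ℝ) * q (n - 1)

end

/-! For `Re s > 1` the difference `Γ(s) ζ(s) - Γ(s - 1)` is the Mellin transform of `1 / (e^x - 1) -
e^(-x) / x`, and `Γ(s - 1) = Γ(s) / (s - 1)`. This kernel is bounded near `0` and decays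
exponentially, so by analytic continuation `ζ(s) - 1 / (s - 1)` equals `1 / Γ(s)` times its Mellin
transform on all of `Re s > 0` (`riemannZeta₀_eq_mellin`).

Take `n` derivatives at `s = 1` by the Leibniz rule. Those of the Mellin transform are the moments
of the kernel against powers of `log x`, and `t = e^(-x)` turns them into the stated integrals.
Those of `1 / Γ` are Bell polynomials: `(1 / Γ)' = -ψ / Γ` gives them the recurrence of
`completeBell_succ`, which is proved by deleting a part from a partition.

For uniqueness, an Appell sequence is determined by its constants of integration, and each constant
is fixed by one integral because the kernel has nonzero total mass. -/

open Filter Topology Set MeasureTheory Asymptotics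

/-! ### Mellin transforms with logarithmic weights -/

/-- The hypotheses under which a Mellin transform and those of all products with powers of `log`
exist on the right half plane. -/
structure IsMellinKernel (f : ℝ → ℂ) : Prop where
  locallyIntegrableOn : LocallyIntegrableOn f (Ioi 0)
  isBigO_atTop : ∀ a : ℝ, f =O[atTop] (· ^ (-a))
  isBigO_zero : ∀ b : ℝ, 0 < b → f =O[𝓝[>] 0] (· ^ (-b))

namespace IsMellinKernel

variable {f : ℝ → ℂ}

/-- A logarithm costs an arbitrarily small power at either end, which the quantifiers over all `a`
and all `b > 0` absorb. -/
theorem log_smul (hf : IsMellinKernel f) : IsMellinKernel fun t => Real.log t • f t where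
  locallyIntegrableOn :=
    hf.locallyIntegrableOn.continuousOn_smul isOpen_Ioi.isLocallyClosed
      (Real.continuousOn_log.mono fun _ hx => ne_of_gt hx)
  isBigO_atTop a := isBigO_rpow_top_log_smul (lt_add_one a) (hf.isBigO_atTop (a + 1))
  isBigO_zero _ hb := isBigO_rpow_zero_log_smul (half_lt_self hb) (hf.isBigO_zero _ (half_pos hb))

theorem log_pow_smul (hf : IsMellinKernel f) (n : ℕ) :
    IsMellinKernel fun t => Real.log t ^ n • f t := by
  induction n with
  | zero => simpa using hf
  | succ n ih => simpa only [pow_succ', mul_smul] using ih.log_smul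

theorem mellinConvergent (hf : IsMellinKernel f) {s : ℂ} (hs : 0 < s.re) :
    MellinConvergent f s :=
  mellinConvergent_of_isBigO_rpow hf.locallyIntegrableOn (hf.isBigO_atTop (s.re + 1))
    (lt_add_one _) (hf.isBigO_zero _ (half_pos hs)) (half_lt_self hs)

theorem hasDerivAt_mellin (hf : IsMellinKernel f) {s : ℂ} (hs : 0 < s.re) :
    HasDerivAt (mellin f) (mellin (fun t => Real.log t • f t) s) s :=
  (mellin_hasDerivAt_of_isBigO_rpow hf.locallyIntegrableOn (hf.isBigO_atTop (s.re + 1))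
    (lt_add_one _) (hf.isBigO_zero _ (half_pos hs)) (half_lt_self hs)).2

theorem iteratedDeriv_mellin (hf : IsMellinKernel f) (n : ℕ) {s : ℂ} (hs : 0 < s.re) :
    iteratedDeriv n (mellin f) s = mellin (fun t => Real.log t ^ n • f t) s := by
  induction n generalizing s with
  | zero => simp
  | succ n ih =>
    have h : iteratedDeriv n (mellin f) =ᶠ[𝓝 s] mellin (fun t => Real.log t ^ n • f t) := by
      filter_upwards [(isOpen_lt continuous_const Complex.continuous_re).mem_nhds hs] with z hz
      exact ih hz
    rw [iteratedDeriv_succ, h.deriv_eq, ((hf.log_pow_smul n).hasDerivAt_mellin hs).deriv]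
    simp only [pow_succ', mul_smul]

end IsMellinKernel

/-! ### The kernel and its Mellin transform -/

/-- The function whose Mellin transform is `Γ(s) (ζ(s) - 1 / (s - 1))`. -/
noncomputable def zetaKernel (x : ℝ) : ℝ := 1 / (Real.exp x - 1) - Real.exp (-x) / x

theorem zetaKernel_pos {x : ℝ} (hx : 0 < x) : 0 < zetaKernel x := by
  have h1 : 1 < Real.exp x := Real.one_lt_exp_iff.2 hx
  have h2 : -x + 1 < Real.exp (-x) := Real.add_one_lt_exp (by linarith)
  have h3 : Real.exp (-x) * Real.exp x = 1 := by rw [← Real.exp_add]; simp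
  rw [zetaKernel, sub_pos, div_lt_div_iff₀ hx (by linarith)]
  nlinarith

/-- The poles `1 / x` of the two terms cancel: `1 + u ≤ e^u` at `u = x` and `u = -x` bounds each
term on the side needed. -/
theorem zetaKernel_le_one {x : ℝ} (hx : 0 < x) : zetaKernel x ≤ 1 := by
  have h1 : x + 1 ≤ Real.exp x := Real.add_one_le_exp x
  have h2 : -x + 1 ≤ Real.exp (-x) := Real.add_one_le_exp (-x)
  have h3 : 1 / (Real.exp x - 1) ≤ 1 / x := one_div_le_one_div_of_le hx (by linarith)
  have h4 : (1 - x) / x ≤ Real.exp (-x) / x := by gcongr; linarith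
  have h5 : (1 - x) / x = 1 / x - 1 := by field_simp
  rw [zetaKernel]; linarith

theorem zetaKernel_le_exp {x : ℝ} (hx : 1 ≤ x) : zetaKernel x ≤ 2 * Real.exp (-x) := by
  have h1 : x + 1 ≤ Real.exp x := Real.add_one_le_exp x
  -- Since `x ≥ 1`, `e^x ≥ 2`, hence `e^x - 1 ≥ e^x / 2`.
  have h3 : 1 / (Real.exp x - 1) ≤ 1 / (Real.exp x / 2) :=
    one_div_le_one_div_of_le (by positivity) (by linarith)
  have h4 : 0 ≤ Real.exp (-x) / x := by positivity
  have h5 : 1 / (Real.exp x / 2) = 2 * Real.exp (-x) := by rw [Real.exp_neg]; field_simp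
  rw [zetaKernel]; linarith

theorem continuousOn_zetaKernel : ContinuousOn zetaKernel (Ioi 0) := by
  unfold zetaKernel
  refine ContinuousOn.sub (continuousOn_const.div (by fun_prop) fun x hx => ?_)
    (ContinuousOn.div (by fun_prop) continuousOn_id fun _ hx => ne_of_gt hx)
  exact (sub_pos.2 (Real.one_lt_exp_iff.2 hx)).ne'

theorem isMellinKernel_zetaKernel : IsMellinKernel fun x => (zetaKernel x : ℂ) where
  locallyIntegrableOn :=
    (Complex.continuous_ofReal.comp_continuousOn continuousOn_zetaKernel).locallyIntegrableOn
      measurableSet_Ioi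
  isBigO_atTop a := by
    refine IsBigO.trans (g := fun x : ℝ => Real.exp (-1 * x)) (IsBigO.of_bound 2 ?_)
      (isLittleO_exp_neg_mul_rpow_atTop one_pos (-a)).isBigO
    filter_upwards [eventually_ge_atTop 1] with x hx
    have := zetaKernel_pos (zero_lt_one.trans_le hx)
    rw [Complex.norm_real, Real.norm_of_nonneg this.le, Real.norm_of_nonneg (Real.exp_pos _).le,
      neg_one_mul]
    exact zetaKernel_le_exp hx
  isBigO_zero b hb := by
    refine IsBigO.of_bound 1 ?_
    filter_upwards [Ioo_mem_nhdsGT one_pos] with x hx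
    have := zetaKernel_pos hx.1
    rw [Complex.norm_real, Real.norm_of_nonneg this.le,
      Real.norm_of_nonneg (Real.rpow_nonneg hx.1.le _), one_mul]
    exact (zetaKernel_le_one hx.1).trans
      (Real.one_le_rpow_of_pos_of_le_one_of_nonpos hx.1 hx.2.le (by linarith))

/-- Expand in the geometric series `∑ e^(-(i + 1) x)` and integrate termwise; each term contributes
`Γ(s) / (i + 1)^s`. -/
theorem mellin_one_div_exp_sub_one {s : ℂ} (hs : 1 < s.re) :
    mellin (fun x : ℝ => ((1 / (Real.exp x - 1) : ℝ) : ℂ)) s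
      = Complex.Gamma s * riemannZeta s := by
  have h := hasSum_mellin (ι := ℕ) (a := fun _ => 1) (p := fun i => (i : ℝ) + 1)
    (F := fun x : ℝ => ((1 / (Real.exp x - 1) : ℝ) : ℂ)) (s := s)
    (fun i => Or.inr (by positivity)) (by linarith) ?_ ?_
  · rw [← h.tsum_eq, zeta_eq_tsum_one_div_nat_add_one_cpow hs, ← tsum_mul_left]
    refine tsum_congr fun i => ?_
    push_cast
    ring
  · intro t ht
    have h0 : Real.exp (-t) < 1 := Real.exp_lt_one_iff.2 (by simpa using ht)
    have h1 := (hasSum_geometric_of_lt_one (Real.exp_pos (-t)).le h0).mul_left (Real.exp (-t))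
    have h2 : Real.exp (-t) * (1 - Real.exp (-t))⁻¹ = 1 / (Real.exp t - 1) := by
      have : 1 < Real.exp t := Real.one_lt_exp_iff.2 ht
      have h3 : Real.exp t - 1 ≠ 0 := by linarith
      have h4 : 1 - Real.exp (-t) ≠ 0 := by linarith
      rw [Real.exp_neg] at h4 ⊢
      field_simp at h4 ⊢
    rw [h2] at h1
    have h5 := Complex.hasSum_ofReal.2 h1
    refine h5.congr_fun ?_
    intro i
    rw [one_mul, ← Real.exp_nat_mul, ← Real.exp_add]
    congr 2
    ring
  · simp only [norm_one]
    exact_mod_cast (summable_nat_add_iff 1).2 (Real.summable_one_div_nat_rpow.2 hs)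

theorem hasMellin_exp_neg_div {s : ℂ} (hs : 1 < s.re) :
    HasMellin (fun x : ℝ => ((Real.exp (-x) / x : ℝ) : ℂ)) s (Complex.Gamma (s - 1)) := by
  have hs' : 0 < (s - 1).re := by simpa using hs
  have e : EqOn (fun x : ℝ => ((Real.exp (-x) : ℝ) : ℂ) * (x : ℂ) ^ (s - 1 - 1))
      (fun x : ℝ => (x : ℂ) ^ (s - 1) • ((Real.exp (-x) / x : ℝ) : ℂ)) (Ioi 0) := by
    intro x hx
    have hx' : (x : ℂ) ≠ 0 := by exact_mod_cast (ne_of_gt hx)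
    simp only [smul_eq_mul]
    rw [Complex.cpow_sub _ 1 hx', Complex.cpow_one]
    push_cast
    ring
  refine ⟨(Complex.GammaIntegral_convergent hs').congr_fun e measurableSet_Ioi, ?_⟩
  rw [Complex.Gamma_eq_integral hs', Complex.GammaIntegral, mellin]
  exact (setIntegral_congr_fun measurableSet_Ioi e).symm

theorem mellin_zetaKernel_of_one_lt_re {s : ℂ} (hs : 1 < s.re) :
    mellin (fun x => (zetaKernel x : ℂ)) s = Complex.Gamma s * riemannZeta₀ s := by
  have h1 := isMellinKernel_zetaKernel.mellinConvergent (s := s) (by linarith)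
  have h2 := hasMellin_exp_neg_div hs
  have h3 := hasMellin_add h1 h2.1
  have h4 : (fun x : ℝ => (zetaKernel x : ℂ) + ((Real.exp (-x) / x : ℝ) : ℂ))
      = fun x : ℝ => ((1 / (Real.exp x - 1) : ℝ) : ℂ) := by
    funext x
    rw [← Complex.ofReal_add, zetaKernel, sub_add_cancel]
  rw [h4, h2.2] at h3
  have h5 := h3.2
  rw [mellin_one_div_exp_sub_one hs] at h5
  have hs1 : s - 1 ≠ 0 := fun h => by
    have := congrArg Complex.re h
    simp at this; linarith
  have h6 := Complex.Gamma_add_one (s - 1) hs1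
  rw [sub_add_cancel] at h6
  have h7 : riemannZeta₀ s = riemannZeta s - (s - 1)⁻¹ := by
    simp [riemannZeta₀, sub_ne_zero.1 hs1]
  rw [h7, mul_sub, h5, h6]
  field_simp
  ring

theorem isOpen_rightHalfPlane : IsOpen {s : ℂ | 0 < s.re} :=
  isOpen_lt continuous_const Complex.continuous_re

theorem differentiableOn_Gamma_rightHalfPlane :
    DifferentiableOn ℂ Complex.Gamma {s : ℂ | 0 < s.re} := fun s hs =>
  (Complex.differentiableAt_Gamma s fun m h => by
    have hs : 0 < s.re := hs
    rw [h] at hs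
    simp at hs
    linarith [(m.cast_nonneg : (0 : ℝ) ≤ m)]).differentiableWithinAt

/-- Both sides, multiplied by `Γ`, are analytic on the connected half plane and agree near `2`, so
the identity theorem extends the equality to a neighbourhood of `1`. -/
theorem riemannZeta₀_eq_mellin {s : ℂ} (hs : 0 < s.re) :
    riemannZeta₀ s = (Complex.Gamma s)⁻¹ * mellin (fun x => (zetaKernel x : ℂ)) s := by
  have hf : AnalyticOnNhd ℂ (mellin fun x => (zetaKernel x : ℂ)) {s : ℂ | 0 < s.re} :=
    DifferentiableOn.analyticOnNhd (fun z hz =>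
      (isMellinKernel_zetaKernel.hasDerivAt_mellin hz).differentiableAt.differentiableWithinAt)
      isOpen_rightHalfPlane
  have hg : AnalyticOnNhd ℂ (fun s => Complex.Gamma s * riemannZeta₀ s) {s : ℂ | 0 < s.re} :=
    (differentiableOn_Gamma_rightHalfPlane.mul
      differentiable_riemannZeta₀.differentiableOn).analyticOnNhd isOpen_rightHalfPlane
  have h := hf.eqOn_of_preconnected_of_eventuallyEq hg (convex_halfSpace_re_gt 0).isPreconnected
    (z₀ := 2) (by simp) (by
      filter_upwards [(isOpen_lt continuous_const Complex.continuous_re).mem_nhds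
        (show (1 : ℝ) < (2 : ℂ).re by simp)] with z hz
      exact mellin_zetaKernel_of_one_lt_re hz) hs
  rw [h, inv_mul_cancel_left₀ (Complex.Gamma_ne_zero_of_re_pos hs)]

theorem mellin_log_pow_zetaKernel_one (m : ℕ) :
    mellin (fun x => Real.log x ^ m • (zetaKernel x : ℂ)) 1
      = ((∫ x in Ioi (0 : ℝ), Real.log x ^ m * zetaKernel x : ℝ) : ℂ) := by
  rw [mellin, ← integral_complex_ofReal]
  simp

theorem integrableOn_log_pow_mul_zetaKernel (m : ℕ) :
    IntegrableOn (fun x => Real.log x ^ m * zetaKernel x) (Ioi 0) := by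
  have h := (isMellinKernel_zetaKernel.log_pow_smul m).mellinConvergent (s := 1) (by simp)
  rw [IntegrableOn]
  simpa [MellinConvergent, IntegrableOn, ← Complex.ofReal_pow] using h.re

theorem iteratedDeriv_riemannZeta₀_one (n : ℕ) :
    iteratedDeriv n riemannZeta₀ 1 = ∑ k ∈ Finset.range (n + 1), (n.choose k : ℂ) *
      iteratedDeriv k (fun s => (Complex.Gamma s)⁻¹) 1 *
        ((∫ x in Ioi (0 : ℝ), Real.log x ^ (n - k) * zetaKernel x : ℝ) : ℂ) := by
  have h1 : (1 : ℂ) ∈ {s : ℂ | 0 < s.re} := by simp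
  have e : riemannZeta₀ =ᶠ[𝓝 1]
      (fun s => (Complex.Gamma s)⁻¹) * mellin (fun x => (zetaKernel x : ℂ)) := by
    filter_upwards [isOpen_rightHalfPlane.mem_nhds h1] with s hs
    exact riemannZeta₀_eq_mellin hs
  have hf : AnalyticAt ℂ (mellin fun x => (zetaKernel x : ℂ)) 1 :=
    DifferentiableOn.analyticAt (s := {s : ℂ | 0 < s.re}) (fun z hz =>
      (isMellinKernel_zetaKernel.hasDerivAt_mellin hz).differentiableAt.differentiableWithinAt)
      (isOpen_rightHalfPlane.mem_nhds h1)
  rw [e.iteratedDeriv_eq, iteratedDeriv_mul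
    (Complex.differentiable_one_div_Gamma.contDiff.contDiffAt) hf.contDiffAt]
  refine Finset.sum_congr rfl fun k _ => ?_
  rw [isMellinKernel_zetaKernel.iteratedDeriv_mellin _ (by simp), mellin_log_pow_zetaKernel_one]

/-! ### The substitution `t = e^(-x)` -/

theorem image_exp_neg_Ioi_zero : (fun x : ℝ => Real.exp (-x)) '' Ioi 0 = Ioo 0 1 := by
  ext t
  constructor
  · rintro ⟨x, hx, rfl⟩
    have hx : 0 < x := hx
    exact ⟨Real.exp_pos _, by rw [← Real.exp_zero]; exact Real.exp_lt_exp.2 (by linarith)⟩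
  · rintro ⟨h0, h1⟩
    exact ⟨-Real.log t, by simpa using Real.log_neg h0 h1, by simp [Real.exp_log h0]⟩

theorem hasDerivWithinAt_exp_neg (s : Set ℝ) (x : ℝ) :
    HasDerivWithinAt (fun x : ℝ => Real.exp (-x)) (-Real.exp (-x)) s x := by
  simpa using ((hasDerivAt_neg x).exp).hasDerivWithinAt

theorem injOn_exp_neg (s : Set ℝ) : InjOn (fun x : ℝ => Real.exp (-x)) s := fun x _ y _ h => by
  simpa using h

theorem abs_deriv_smul_comp_exp_neg (h : ℝ → ℝ) {x : ℝ} (hx : 0 < x) :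
    |-Real.exp (-x)| • (h (Real.log (Real.log (1 / Real.exp (-x)))) *
      (1 / Real.log (Real.exp (-x)) + 1 / (1 - Real.exp (-x)))) =
      h (Real.log x) * zetaKernel x := by
  have h1 : 1 < Real.exp x := Real.one_lt_exp_iff.2 hx
  have h2 : Real.exp x - 1 ≠ 0 := by linarith
  have h3 : Real.exp (-x) * (1 / (1 - Real.exp (-x))) = 1 / (Real.exp x - 1) := by
    have h4 : 1 - (Real.exp x)⁻¹ ≠ 0 := by
      have := inv_lt_one_of_one_lt₀ h1
      linarith
    rw [Real.exp_neg]
    field_simp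
  rw [abs_neg, abs_of_pos (Real.exp_pos _), smul_eq_mul, Real.log_exp, one_div (Real.exp (-x)),
    ← Real.exp_neg, neg_neg, Real.log_exp, zetaKernel, ← h3]
  have : x ≠ 0 := hx.ne'
  field_simp
  ring

theorem intervalIntegrable_iff_integrableOn_zetaKernel (h : ℝ → ℝ) :
    IntervalIntegrable (fun t : ℝ => h (Real.log (Real.log (1 / t))) *
      (1 / Real.log t + 1 / (1 - t))) volume 0 1 ↔
      IntegrableOn (fun x => h (Real.log x) * zetaKernel x) (Ioi 0) := by
  rw [intervalIntegrable_iff_integrableOn_Ioo_of_le zero_le_one, ← image_exp_neg_Ioi_zero,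
    integrableOn_image_iff_integrableOn_abs_deriv_smul measurableSet_Ioi
      (fun x _ => hasDerivWithinAt_exp_neg _ x) (injOn_exp_neg _)]
  exact integrableOn_congr_fun (fun x hx => abs_deriv_smul_comp_exp_neg h hx) measurableSet_Ioi

theorem intervalIntegral_eq_integral_zetaKernel (h : ℝ → ℝ) :
    ∫ t in (0 : ℝ)..1, h (Real.log (Real.log (1 / t))) * (1 / Real.log t + 1 / (1 - t)) =
      ∫ x in Ioi (0 : ℝ), h (Real.log x) * zetaKernel x := by
  rw [intervalIntegral.integral_of_le zero_le_one, integral_Ioc_eq_integral_Ioo,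
    ← image_exp_neg_Ioi_zero, integral_image_eq_integral_abs_deriv_smul measurableSet_Ioi
      (fun x _ => hasDerivWithinAt_exp_neg _ x) (injOn_exp_neg _)]
  exact setIntegral_congr_fun measurableSet_Ioi fun x hx => abs_deriv_smul_comp_exp_neg h hx

theorem intervalIntegrable_log_log_pow (m : ℕ) :
    IntervalIntegrable (fun t : ℝ => Real.log (Real.log (1 / t)) ^ m *
      (1 / Real.log t + 1 / (1 - t))) volume 0 1 :=
  (intervalIntegrable_iff_integrableOn_zetaKernel (· ^ m)).2 (integrableOn_log_pow_mul_zetaKernel m)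

/-- Positivity comes from `log t < t - 1`. It is what determines the constants of integration in the
uniqueness proof. -/
theorem integral_one_div_log_add_pos :
    0 < ∫ t in (0 : ℝ)..1, (1 / Real.log t + 1 / (1 - t)) := by
  have hi := intervalIntegrable_log_log_pow 0
  simp only [pow_zero, one_mul] at hi
  refine intervalIntegral.intervalIntegral_pos_of_pos_on hi (fun t ht => ?_) one_pos
  have h1 : Real.log t < t - 1 := Real.log_lt_sub_one_of_pos ht.1 ht.2.ne
  have h2 : 1 / (t - 1) < 1 / Real.log t :=
    one_div_lt_one_div_of_neg_of_lt (by linarith [ht.2]) h1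
  have h3 : 1 / (1 - t) = -(1 / (t - 1)) := by rw [← neg_sub t 1, div_neg]
  linarith

/-! ### Recurrence for the complete Bell polynomials -/

/-- The weight of a multiset of parts `j`, each of which contributes `a j`, divided by the number
of permutations of equal parts. -/
noncomputable def partWeight (a : ℕ → ℝ) (N : ℕ) (s : Multiset ℕ) : ℝ :=
  ∏ j ∈ Finset.Icc 1 N, a j ^ s.count j / ((s.count j).factorial : ℝ)

/-- With `c` the new multiplicity, `c * a^c / c! = a * a^(c-1) / (c-1)!`; the other factors do not
change. -/
theorem count_mul_partWeight_cons (a : ℕ → ℝ) {N j : ℕ} (hj : j ∈ Finset.Icc 1 N)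
    (s : Multiset ℕ) :
    ((j ::ₘ s).count j : ℝ) * partWeight a N (j ::ₘ s) = a j * partWeight a N s := by
  rw [partWeight, partWeight, ← Finset.mul_prod_erase _ _ hj, ← Finset.mul_prod_erase _ _ hj]
  have h : ∏ i ∈ (Finset.Icc 1 N).erase j,
      a i ^ (j ::ₘ s).count i / (((j ::ₘ s).count i).factorial : ℝ) =
      ∏ i ∈ (Finset.Icc 1 N).erase j, a i ^ s.count i / ((s.count i).factorial : ℝ) :=
    Finset.prod_congr rfl fun i hi => by
      rw [Multiset.count_cons_of_ne (Finset.ne_of_mem_erase hi)]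
  rw [h, Multiset.count_cons_self, pow_succ, Nat.factorial_succ]
  have h1 : ((s.count j : ℝ) + 1) ≠ 0 := by positivity
  have h2 : ((s.count j).factorial : ℝ) ≠ 0 := by positivity
  push_cast
  field_simp

theorem partWeight_eq_of_le (a : ℕ → ℝ) {n N : ℕ} (h : n ≤ N) (π : n.Partition) :
    partWeight a n π.parts = partWeight a N π.parts := by
  refine Finset.prod_subset (Finset.Icc_subset_Icc_right h) fun j _ hj => ?_
  have : j ∉ π.parts := fun hm => hj <| Finset.mem_Icc.2
    ⟨π.parts_pos hm, π.parts_sum ▸ Multiset.single_le_sum (fun _ _ => Nat.zero_le _) _ hm⟩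
  simp [Multiset.count_eq_zero_of_notMem this]

/-- Insert the part `j` into a partition. -/
def insertPart {m j n : ℕ} (hj : 0 < j) (h : m + j = n) (π : m.Partition) : n.Partition where
  parts := j ::ₘ π.parts
  parts_pos := fun {i} hi => by
    rcases Multiset.mem_cons.1 hi with rfl | hi
    · exact hj
    · exact π.parts_pos hi
  parts_sum := by rw [Multiset.sum_cons, π.parts_sum, add_comm, h]

theorem insertPart_injective {m j n : ℕ} (hj : 0 < j) (h : m + j = n) :
    Function.Injective (insertPart hj h) := fun π ρ e => by
  have := congrArg Nat.Partition.parts e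
  exact Nat.Partition.ext (by simpa [insertPart] using this)

theorem mem_range_insertPart {m j n : ℕ} (hj : 0 < j) (h : m + j = n) (π : n.Partition)
    (hπ : j ∈ π.parts) : ∃ ρ, insertPart hj h ρ = π := by
  refine ⟨⟨π.parts.erase j, fun hi => π.parts_pos (Multiset.mem_of_mem_erase hi), ?_⟩,
    Nat.Partition.ext (Multiset.cons_erase hπ)⟩
  have := Multiset.sum_erase hπ
  rw [π.parts_sum] at this
  omega

/-- Partitions without the part `j` contribute zero; the others correspond to partitions of `n - j`
by removing one copy of `j`. -/
theorem sum_count_mul_partWeight (a : ℕ → ℝ) {m j n : ℕ} (hj : 0 < j) (h : m + j = n) :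
    ∑ π : n.Partition, (π.parts.count j : ℝ) * partWeight a n π.parts =
      a j * ∑ π : m.Partition, partWeight a m π.parts := by
  rw [Finset.mul_sum]
  refine (Finset.sum_of_injOn (insertPart hj h) (insertPart_injective hj h).injOn
    (fun _ _ => Finset.mem_coe.2 (Finset.mem_univ _)) (fun π _ hπ => ?_) fun π _ => ?_).symm
  · have : j ∉ π.parts := fun hm => hπ <| by
      obtain ⟨ρ, hρ⟩ := mem_range_insertPart hj h π hm
      exact ⟨ρ, Finset.mem_coe.2 (Finset.mem_univ _), hρ⟩
    simp [Multiset.count_eq_zero_of_notMem this]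
  · rw [partWeight_eq_of_le a (show m ≤ n by omega)]
    exact (count_mul_partWeight_cons a (Finset.mem_Icc.2 ⟨hj, by omega⟩) π.parts).symm

theorem sum_Icc_mul_count {n : ℕ} (π : n.Partition) :
    ∑ j ∈ Finset.Icc 1 n, j * π.parts.count j = n := by
  have h := Finset.sum_multiset_count_of_subset π.parts (Finset.Icc 1 n) fun j hj => by
    have hm := Multiset.mem_toFinset.1 hj
    exact Finset.mem_Icc.2
      ⟨π.parts_pos hm, π.parts_sum ▸ Multiset.single_le_sum (fun _ _ => Nat.zero_le _) _ hm⟩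
  rw [π.parts_sum] at h
  simpa [mul_comm] using h.symm

theorem completeBell_eq (n : ℕ) (x : ℕ → ℝ) :
    completeBell n x = (n.factorial : ℝ) *
      ∑ π : n.Partition, partWeight (fun j => x j / (j.factorial : ℝ)) n π.parts := by
  rw [completeBell, Finset.mul_sum]
  refine Finset.sum_congr rfl fun π _ => ?_
  rw [partWeight, Finset.prod_div_distrib]
  ring

theorem completeBell_zero (x : ℕ → ℝ) : completeBell 0 x = 1 := by
  simp [completeBell]

/-- Write the factor `n + 1` of `(n + 1)!` as the sum of `j * count j` over the parts of each
partition, exchange the sums and delete one part `j = k + 1`. -/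
theorem completeBell_succ (n : ℕ) (x : ℕ → ℝ) :
    completeBell (n + 1) x =
      ∑ k ∈ Finset.range (n + 1), (n.choose k : ℝ) * x (k + 1) * completeBell (n - k) x := by
  set a : ℕ → ℝ := fun j => x j / (j.factorial : ℝ) with ha
  have key : ((n + 1 : ℕ) : ℝ) * ∑ π : (n + 1).Partition, partWeight a (n + 1) π.parts =
      ∑ k ∈ Finset.range (n + 1), ((k + 1 : ℕ) : ℝ) *
        (a (k + 1) * ∑ π : (n - k).Partition, partWeight a (n - k) π.parts) := by
    have h1 (π : (n + 1).Partition) : ((n + 1 : ℕ) : ℝ) * partWeight a (n + 1) π.parts =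
        ∑ k ∈ Finset.range (n + 1), ((k + 1 : ℕ) : ℝ) *
          ((π.parts.count (k + 1) : ℝ) * partWeight a (n + 1) π.parts) := by
      have h := sum_Icc_mul_count π
      rw [Finset.range_eq_Ico, Finset.sum_Ico_add' (fun j => ((j : ℕ) : ℝ) *
        ((π.parts.count j : ℝ) * partWeight a (n + 1) π.parts)), zero_add,
        show Finset.Ico 1 (n + 1 + 1) = Finset.Icc 1 (n + 1) from rfl]
      simp only [← mul_assoc]
      rw [← Finset.sum_mul]
      congr 1
      exact_mod_cast h.symm
    rw [Finset.mul_sum, Finset.sum_congr rfl fun π _ => h1 π, Finset.sum_comm]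
    refine Finset.sum_congr rfl fun k hk => ?_
    rw [← Finset.mul_sum, sum_count_mul_partWeight a k.succ_pos (m := n - k)]
    have := Finset.mem_range.1 hk
    omega
  rw [completeBell_eq, Nat.factorial_succ, Nat.cast_mul, mul_comm ((n + 1 : ℕ) : ℝ), mul_assoc,
    key, Finset.mul_sum]
  refine Finset.sum_congr rfl fun k hk => ?_
  rw [completeBell_eq, Nat.cast_choose ℝ (Nat.lt_succ_iff.1 (Finset.mem_range.1 hk)), ha]
  simp only [Nat.factorial_succ]
  have h1 : (k.factorial : ℝ) ≠ 0 := by positivity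
  have h2 : ((n - k).factorial : ℝ) ≠ 0 := by positivity
  have h3 : (k : ℝ) + 1 ≠ 0 := by positivity
  push_cast
  field_simp

/-! ### Derivatives of `1 / Γ` at `1` -/

theorem ofReal_iteratedDeriv {f : ℂ → ℂ} {g : ℝ → ℝ}
    (hf : DifferentiableOn ℂ f {s : ℂ | 0 < s.re}) (hg : ∀ x : ℝ, 0 < x → (g x : ℂ) = f x)
    (n : ℕ) {x : ℝ} (hx : 0 < x) : ((iteratedDeriv n g x : ℝ) : ℂ) = iteratedDeriv n f x := by
  have hU := isOpen_rightHalfPlane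
  induction n generalizing x with
  | zero => simpa using hg x hx
  | succ n ih =>
    have ha : AnalyticOnNhd ℂ (iteratedDeriv n f) {s : ℂ | 0 < s.re} := by
      simpa only [iteratedDeriv_eq_iterate] using (hf.analyticOnNhd hU).iterated_deriv n
    have hd : HasDerivAt (iteratedDeriv n f) (iteratedDeriv (n + 1) f x) (x : ℂ) := by
      rw [iteratedDeriv_succ]
      exact (ha x (by simpa using hx)).differentiableAt.hasDerivAt
    have he : ∀ᶠ y in 𝓝 x, ((iteratedDeriv n g y : ℝ) : ℂ) = iteratedDeriv n f y := by
      filter_upwards [lt_mem_nhds hx] with y hy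
      exact ih hy
    -- Real differentiability is inherited from the complex function through its real part;
    -- uniqueness of derivatives along the real axis then identifies the two values.
    have hr : HasDerivAt (iteratedDeriv n g) (iteratedDeriv (n + 1) f x).re x :=
      hd.real_of_complex.congr_of_eventuallyEq (he.mono fun y hy => by simp [← hy])
    rw [iteratedDeriv_succ, hr.deriv]
    exact hr.ofReal_comp.unique (hd.comp_ofReal.congr_of_eventuallyEq he)

/-- The Leibniz rule applied to `(1 / Γ)' = -ψ * (1 / Γ)` is the Bell recurrence with `x_(k+1) =
-ψ^(k)(1)`, and both start at `1`. -/
theorem ofReal_bellPsi (n : ℕ) :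
    ((bellPsi n : ℝ) : ℂ) = iteratedDeriv n (fun s => (Complex.Gamma s)⁻¹) 1 := by
  have hU := isOpen_rightHalfPlane
  have h1 : (1 : ℂ) ∈ {s : ℂ | 0 < s.re} := by simp
  have hG := differentiableOn_Gamma_rightHalfPlane
  have hψ : DifferentiableOn ℂ Complex.digamma {s : ℂ | 0 < s.re} :=
    (hG.deriv hU).div hG fun s hs => Complex.Gamma_ne_zero_of_re_pos hs
  have hd : deriv (fun s => (Complex.Gamma s)⁻¹) =ᶠ[𝓝 1]
      (fun s => -Complex.digamma s) * fun s => (Complex.Gamma s)⁻¹ := by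
    filter_upwards [hU.mem_nhds h1] with s hs
    have h0 := Complex.Gamma_ne_zero_of_re_pos hs
    rw [deriv_fun_inv'' (hG.differentiableAt (hU.mem_nhds hs)) h0, Pi.mul_apply,
      Complex.digamma_def, logDeriv_apply]
    field_simp
  have hn : AnalyticAt ℂ (fun s => -Complex.digamma s) 1 :=
    (hψ.analyticAt (hU.mem_nhds h1)).neg
  induction n using Nat.strong_induction_on with
  | _ n ih =>
    cases n with
    | zero => simp [bellPsi, completeBell_zero]
    | succ n =>
      rw [iteratedDeriv_succ', hd.iteratedDeriv_eq, iteratedDeriv_mul hn.contDiffAt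
        Complex.differentiable_one_div_Gamma.contDiff.contDiffAt, bellPsi, completeBell_succ]
      push_cast
      refine Finset.sum_congr rfl fun k _ => ?_
      have h2 := ih (n - k) (by omega)
      have h3 := ofReal_iteratedDeriv hψ (fun x hx => ofReal_realDigamma hx) k one_pos
      rw [Complex.ofReal_one] at h3
      rw [← h2, iteratedDeriv_fun_neg, ← h3, bellPsi]

theorem stieltjesConstant_eq_sum_bellPsi (n : ℕ) : stieltjesConstant n =
    (((-1) ^ n * ∑ k ∈ Finset.range (n + 1), (n.choose k : ℝ) * bellPsi k *
      ∫ t in (0 : ℝ)..1,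
        Real.log (Real.log (1 / t)) ^ (n - k) * (1 / Real.log t + 1 / (1 - t)) : ℝ) : ℂ) := by
  rw [stieltjesConstant, iteratedDeriv_riemannZeta₀_one]
  push_cast
  congr 1
  refine Finset.sum_congr rfl fun k _ => ?_
  rw [← ofReal_bellPsi, ← intervalIntegral_eq_integral_zetaKernel (· ^ (n - k))]

/-! ### Appell sequences -/

theorem bredePoly_eval (n : ℕ) (z : ℝ) : (bredePoly n).eval z =
    ∑ k ∈ Finset.range (n + 1), (n.choose k : ℝ) * (-1) ^ k * bellPsi k * z ^ (n - k) := by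
  simp [bredePoly, eval_finsetSum]

theorem bredePoly_eval_reverse (n : ℕ) (z : ℝ) : (bredePoly n).eval z =
    ∑ k ∈ Finset.range (n + 1), (n.choose k : ℝ) * (-1) ^ (n - k) * bellPsi (n - k) * z ^ k := by
  rw [bredePoly_eval, ← Finset.sum_range_reflect]
  refine Finset.sum_congr rfl fun k hk => ?_
  have hk := Nat.lt_succ_iff.1 (Finset.mem_range.1 hk)
  rw [Nat.add_sub_cancel, Nat.choose_symm hk, Nat.sub_sub_self hk]

theorem bellPsi_zero : bellPsi 0 = 1 := completeBell_zero _

theorem bredePoly_coeff (n m : ℕ) : (bredePoly n).coeff m =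
    if m ≤ n then (n.choose m : ℝ) * (-1) ^ (n - m) * bellPsi (n - m) else 0 := by
  rw [bredePoly, finsetSum_coeff]
  simp only [coeff_C_mul, coeff_X_pow]
  split_ifs with h
  · rw [Finset.sum_eq_single (n - m)]
    · rw [Nat.choose_symm h, if_pos (Nat.sub_sub_self h).symm, mul_one]
    · intro k hk hne
      have := Finset.mem_range.1 hk
      rw [if_neg (by omega), mul_zero]
    · intro hk
      exact absurd (Finset.mem_range.2 (by omega)) hk
  · refine Finset.sum_eq_zero fun k _ => ?_
    rw [if_neg (by omega), mul_zero]

theorem bredePoly_degree (n : ℕ) : (bredePoly n).degree = n := by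
  refine degree_eq_of_le_of_coeff_ne_zero ?_ ?_
  · refine degree_le_iff_coeff_zero _ _ |>.2 fun m hm => ?_
    rw [bredePoly_coeff, if_neg (by exact_mod_cast hm.not_ge)]
  · simp [bredePoly_coeff, bellPsi_zero]

theorem derivative_bredePoly (n : ℕ) (hn : 1 ≤ n) :
    derivative (bredePoly n) = C (n : ℝ) * bredePoly (n - 1) := by
  obtain ⟨n, rfl⟩ := Nat.exists_eq_add_of_le' hn
  ext m
  rw [coeff_derivative, coeff_C_mul, bredePoly_coeff, bredePoly_coeff, Nat.add_sub_cancel,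
    Nat.add_sub_add_right]
  simp only [Nat.add_le_add_iff_right]
  split_ifs
  · have h : ((n + 1 : ℕ) : ℝ) * (n.choose m : ℝ) =
        ((n + 1).choose (m + 1) : ℝ) * ((m : ℝ) + 1) := by
      exact_mod_cast Nat.add_one_mul_choose_eq n m
    rw [← mul_assoc, ← mul_assoc, h]
    ring
  · simp

theorem isAppellSequence_bredePoly : IsAppellSequence bredePoly :=
  ⟨bredePoly_degree, derivative_bredePoly⟩

theorem eq_add_C_of_derivative_eq {p q : ℝ[X]} (h : derivative p = derivative q) :
    p = q + C (p.coeff 0 - q.coeff 0) := by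
  have h1 : derivative (p - q) = 0 := by rw [derivative_sub, h, sub_self]
  have h2 := eq_C_of_derivative_eq_zero h1
  rw [coeff_sub] at h2
  rw [← h2]
  ring

theorem IsAppellSequence.eval_add_eq_sum {q : ℕ → ℝ[X]} (hq : IsAppellSequence q) (n : ℕ) (x y : ℝ) :
    (q n).eval (x + y) =
      ∑ k ∈ Finset.range (n + 1), (n.choose k : ℝ) * (q k).eval x * y ^ (n - k) := by
  suffices h : (q n).comp (C x + X) =
      ∑ k ∈ Finset.range (n + 1), C ((n.choose k : ℝ) * (q k).eval x) * X ^ (n - k) by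
    have := congrArg (eval y) h
    simpa [eval_finsetSum] using this
  induction n with
  | zero =>
    obtain ⟨c, hc⟩ : ∃ c, q 0 = C c := ⟨_, eq_C_of_degree_le_zero (hq.1 0).le⟩
    simp [hc]
  | succ n ih =>
    -- As polynomials in `y`, both sides have equal derivatives by induction and equal values at
    -- `0`, where only the term `k = n + 1` survives.
    have hz : ∀ p r : ℝ[X], derivative p = derivative r → p.eval 0 = r.eval 0 → p = r := by
      intro p r h1 h2
      rw [eq_add_C_of_derivative_eq h1, coeff_zero_eq_eval_zero, coeff_zero_eq_eval_zero, h2]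
      simp
    apply hz
    · rw [derivative_comp, hq.2 (n + 1) (by omega), Nat.add_sub_cancel, mul_comp,
        Finset.sum_range_succ, ih, derivative_add, derivative_add, derivative_sum]
      simp only [Nat.sub_self, pow_zero, mul_one, derivative_C, derivative_X,
        zero_add, one_mul, add_zero, C_comp, Finset.mul_sum]
      refine Finset.sum_congr rfl fun k hk => ?_
      have hk := Nat.lt_succ_iff.1 (Finset.mem_range.1 hk)
      have h : ((n + 1 : ℕ) : ℝ) * (n.choose k : ℝ) =
          ((n + 1).choose k : ℝ) * ((n + 1 - k : ℕ) : ℝ) := by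
        rw [Nat.succ_sub hk]
        exact_mod_cast (by
          rw [mul_comm, Nat.choose_mul_succ_eq, Nat.succ_sub hk] :
            (n + 1) * n.choose k = (n + 1).choose k * (n - k).succ)
      rw [derivative_C_mul, derivative_X_pow, ← mul_assoc, ← mul_assoc, ← C_mul, ← C_mul,
        ← mul_assoc, h, show n + 1 - k - 1 = n - k by omega]
      congr 2
      ring
    · rw [eval_finsetSum, Finset.sum_range_succ, Finset.sum_eq_zero]
      · simp
      · intro k hk
        have hk := Finset.mem_range.1 hk
        rw [eval_mul, eval_pow, eval_X, zero_pow (by omega), mul_zero]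

theorem IsAppellSequence.eval_eq_sum {q : ℕ → ℝ[X]} (hq : IsAppellSequence q) (n : ℕ) (z : ℝ) :
    (q n).eval z =
      ∑ k ∈ Finset.range (n + 1), (n.choose k : ℝ) * (q (n - k)).eval 0 * z ^ k := by
  rw [← zero_add z, hq.eval_add_eq_sum, ← Finset.sum_range_reflect, zero_add]
  refine Finset.sum_congr rfl fun k hk => ?_
  have hk := Nat.lt_succ_iff.1 (Finset.mem_range.1 hk)
  rw [Nat.add_sub_cancel, Nat.choose_symm hk, Nat.sub_sub_self hk]

theorem intervalIntegrable_eval_log_log (p : ℝ[X]) :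
    IntervalIntegrable (fun t : ℝ => p.eval (-Real.log (Real.log (1 / t))) *
      (1 / Real.log t + 1 / (1 - t))) volume 0 1 := by
  have h : (fun t : ℝ => p.eval (-Real.log (Real.log (1 / t))) *
      (1 / Real.log t + 1 / (1 - t))) = ∑ k ∈ Finset.range (p.natDegree + 1),
        fun t => p.coeff k * (-1) ^ k *
          (Real.log (Real.log (1 / t)) ^ k * (1 / Real.log t + 1 / (1 - t))) := by
    funext t
    rw [eval_eq_sum_range, Finset.sum_mul, Finset.sum_apply]
    refine Finset.sum_congr rfl fun k _ => ?_
    rw [neg_pow]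
    ring
  rw [h]
  exact IntervalIntegrable.sum _ fun k _ => (intervalIntegrable_log_log_pow k).const_mul _

/-! ### Integral representation and uniqueness -/

theorem integral_bredePoly (n : ℕ) :
    ∫ t in (0 : ℝ)..1, (bredePoly n).eval (-Real.log (Real.log (1 / t))) *
        (1 / Real.log t + 1 / (1 - t)) =
      (-1) ^ n * ∑ k ∈ Finset.range (n + 1), (n.choose k : ℝ) * bellPsi k *
        ∫ t in (0 : ℝ)..1,
          Real.log (Real.log (1 / t)) ^ (n - k) * (1 / Real.log t + 1 / (1 - t)) := by
  have h (t : ℝ) : (bredePoly n).eval (-Real.log (Real.log (1 / t))) *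
      (1 / Real.log t + 1 / (1 - t)) = ∑ k ∈ Finset.range (n + 1),
        (-1) ^ n * ((n.choose k : ℝ) * bellPsi k) *
          (Real.log (Real.log (1 / t)) ^ (n - k) * (1 / Real.log t + 1 / (1 - t))) := by
    rw [bredePoly_eval, Finset.sum_mul]
    refine Finset.sum_congr rfl fun k hk => ?_
    have hs : ((-1 : ℝ)) ^ n = (-1) ^ k * (-1) ^ (n - k) := by
      rw [← pow_add, Nat.add_sub_cancel' (Nat.lt_succ_iff.1 (Finset.mem_range.1 hk))]
    rw [neg_pow (Real.log _), hs]
    ring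
  simp only [h]
  rw [intervalIntegral.integral_finsetSum fun k _ =>
    (intervalIntegrable_log_log_pow (n - k)).const_mul _, Finset.mul_sum]
  refine Finset.sum_congr rfl fun k _ => ?_
  rw [intervalIntegral.integral_const_mul, mul_assoc]

/-- Two Appell sequences that have the same integrals against the kernel coincide, because the
kernel has a nonzero integral. -/
theorem IsAppellSequence.eq_of_integral_eq {p q : ℕ → ℝ[X]} (hp : IsAppellSequence p)
    (hq : IsAppellSequence q)
    (h : ∀ n : ℕ, ∫ t in (0 : ℝ)..1, (p n).eval (-Real.log (Real.log (1 / t))) *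
        (1 / Real.log t + 1 / (1 - t)) =
      ∫ t in (0 : ℝ)..1, (q n).eval (-Real.log (Real.log (1 / t))) *
        (1 / Real.log t + 1 / (1 - t))) : p = q := by
  -- Equal derivatives leave a constant difference `c`; equal integrals force `c` times the mass of
  -- the kernel to vanish.
  have step (n : ℕ) (hd : derivative (p n) = derivative (q n)) : p n = q n := by
    set c := (p n).coeff 0 - (q n).coeff 0 with hc
    have he : p n = q n + C c := eq_add_C_of_derivative_eq hd
    have hn := h n
    have hi := intervalIntegrable_log_log_pow 0
    simp only [pow_zero, one_mul] at hi
    simp only [he, eval_add, eval_C, add_mul] at hn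
    rw [intervalIntegral.integral_add (intervalIntegrable_eval_log_log (q n)) (hi.const_mul c),
      intervalIntegral.integral_const_mul, add_eq_left] at hn
    rw [he, (mul_eq_zero.1 hn).resolve_right integral_one_div_log_add_pos.ne', C_0, add_zero]
  funext n
  induction n with
  | zero =>
    refine step 0 ?_
    rw [eq_C_of_degree_le_zero (hp.1 0).le, eq_C_of_degree_le_zero (hq.1 0).le, derivative_C,
      derivative_C]
  | succ n ih =>
    refine step (n + 1) ?_
    rw [hp.2 (n + 1) (by omega), hq.2 (n + 1) (by omega), Nat.add_sub_cancel, ih]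

theorem mainTheorem2 :
    -- the Stieltjes constants as combinations of integrals of powers of `log (log (1 / t))`
    (∀ m : ℕ, IntervalIntegrable
      (fun t : ℝ => Real.log (Real.log (1 / t)) ^ m * (1 / Real.log t + 1 / (1 - t)))
      MeasureTheory.volume 0 1) ∧
    (∀ n : ℕ, stieltjesConstant n =
      (((-1) ^ n * ∑ k ∈ Finset.range (n + 1), (n.choose k : ℝ) * bellPsi k *
        ∫ t in (0 : ℝ)..1,
          Real.log (Real.log (1 / t)) ^ (n - k) * (1 / Real.log t + 1 / (1 - t)) : ℝ) : ℂ)) ∧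
    -- `p_n` has degree `n` and represents `γ_n`
    (∀ n : ℕ, (bredePoly n).degree = n) ∧
    (∀ n : ℕ, IntervalIntegrable
      (fun t : ℝ => (bredePoly n).eval (-Real.log (Real.log (1 / t))) *
        (1 / Real.log t + 1 / (1 - t))) MeasureTheory.volume 0 1) ∧
    (∀ n : ℕ, stieltjesConstant n =
      ((∫ t in (0 : ℝ)..1, (bredePoly n).eval (-Real.log (Real.log (1 / t))) *
        (1 / Real.log t + 1 / (1 - t)) : ℝ) : ℂ)) ∧
    -- the two explicit forms of `p_n`
    (∀ (n : ℕ) (z : ℝ), (bredePoly n).eval z =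
      ∑ k ∈ Finset.range (n + 1),
        (n.choose k : ℝ) * (-1) ^ (n - k) * bellPsi (n - k) * z ^ k) ∧
    (∀ (n : ℕ) (z : ℝ), (bredePoly n).eval z =
      ∑ k ∈ Finset.range (n + 1),
        (n.choose k : ℝ) * (-1) ^ k * bellPsi k * z ^ (n - k)) ∧
    -- the Appell property and the resulting relations
    (∀ n : ℕ, 1 ≤ n → derivative (bredePoly n) = C (n : ℝ) * bredePoly (n - 1)) ∧
    IsAppellSequence bredePoly ∧
    (∀ (n : ℕ) (z : ℝ), (bredePoly n).eval z =
      ∑ k ∈ Finset.range (n + 1), (n.choose k : ℝ) * (bredePoly (n - k)).eval 0 * z ^ k) ∧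
    (∀ (n : ℕ) (x y : ℝ), (bredePoly n).eval (x + y) =
      ∑ k ∈ Finset.range (n + 1), (n.choose k : ℝ) * (bredePoly k).eval x * y ^ (n - k)) ∧
    -- no other Appell sequence represents the Stieltjes constants in this way
    (∀ q : ℕ → ℝ[X], IsAppellSequence q →
      (∀ n : ℕ, stieltjesConstant n =
        ((∫ t in (0 : ℝ)..1, (q n).eval (-Real.log (Real.log (1 / t))) *
          (1 / Real.log t + 1 / (1 - t)) : ℝ) : ℂ)) →
      q = bredePoly) := by

  have hint (n : ℕ) : stieltjesConstant n =
      ((∫ t in (0 : ℝ)..1, (bredePoly n).eval (-Real.log (Real.log (1 / t))) *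
        (1 / Real.log t + 1 / (1 - t)) : ℝ) : ℂ) := by
    rw [integral_bredePoly, stieltjesConstant_eq_sum_bellPsi]
  refine ⟨intervalIntegrable_log_log_pow, stieltjesConstant_eq_sum_bellPsi, bredePoly_degree,
    fun n => intervalIntegrable_eval_log_log _, hint, bredePoly_eval_reverse, bredePoly_eval,
    derivative_bredePoly, isAppellSequence_bredePoly, isAppellSequence_bredePoly.eval_eq_sum,
    isAppellSequence_bredePoly.eval_add_eq_sum, fun q hq h => ?_⟩
  exact hq.eq_of_integral_eq isAppellSequence_bredePoly fun n => by
    exact_mod_cast (h n).symm.trans (hint n)
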